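/- Let $q$ be a prime power, and for $v\in\mathbb F_q^{2n}$ write $v=(v_1,\dots,v_{2n})$. The symplectic inner product is $\langle x,y\rangle_{\rm s}=\sum_{k=1}^n (x_ky_{n+k}-x_{n+k}y_k)$, the symplectic weight of $x$ is the number of $k\in\{1,\dots,n\}$ with $(x_k,x_{n+k})\neq(0,0)$, and $C^{\perp_{\rm s}}=\{y\mid \langle x,y\rangle_{\rm s}=0\ \forall x\in C\}$ for a linear code $C\subseteq\mathbb F_q^{2n}$. Such a $C$ is symplectic self-orthogonal (SO) if $C\subseteq C^{\perp_{\rm s}}$ and symplectic dual-containing (DC) if $C^{\perp_{\rm s}}\subseteq C$. It has parameters $[2n,k,d]_q^{\rm s}$ if it has length $2n$, dimension $k$, and the minimum symplectic weight of its nonzero codewords is $d$. The Plotkin sum of linear codes $C_1,C_2\subseteq\mathbb F_q^n$ is $\mathcal P(C_1,C_2)=\{(u,u+v)\mid u\in C_1,\ v\in C_2\}$, and $\perp_{\rm E}$ denotes the dual with respect to $\sum_k x_ky_k$. For integers $r,m\ge 0$, the generalized Reed–Muller code $\mathrm{GRM}(r,m)\subseteq \mathbb F_q^{q^m}$ consists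 of the evaluation vectors $(f(P))_{P\in\mathbb F_q^m}$ of the polynomials $f\in\mathbb F_q[x_1,\dots,x_m]$ of total degree at most $r$ and of degree less than $q$ in each variable. Binomial coefficients with negative lower entry are $0$. Theorem. Let $r,i,m\ge 0$ be integers with $r<m(q-1)$ (so $m\ge 1$) and $i\le m(q-1)-r-1$. Write $m(q-1)-r=a_r(q-1)+b_r$, $m(q-1)-i=a_i(q-1)+b_i$, $r+1=a_r'(q-1)+b_r'$ and $i+1=a_i'(q-1)+b_i'$ with integers $a_r,a_i,a_r',a_i'\ge 0$ and $0\le b_r,b_i,b_r',b_i'<q-1$. Put $$K=\sum_{j=0}^m(-1)^j\binom mj\left[\binom{m+i-jq}{i-jq}+\binom{m+r-jq}{r-jq}\right].$$ Then $\mathrm{GRM}(i,m)\subseteq\mathrm{GRM}(m(q-1)-r-1,m)=\mathrm{GRM}(r,m)^{\perp_{\rm E}}$, and for the Plotkin sum $\mathcal P=\mathcal P(\mathrm{GRM}(i,m),\mathrm{GRM}(r,m))$ the following hold. (1) $\mathcal P$ is a symplectic SO code with parameters $$\left[2q^m,\ K,\ \min\{(b_i+1)q^{a_i},(b_r+1)q^{a_r}\}\right]_q^{\rm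 s}.$$ (2) $\mathcal P^{\perp_{\rm s}}$ is a symplectic DC code with parameters $$\left[2q^m,\ 2q^m-K,\ \min\{(b_i'+1)q^{a_i'},(b_r'+1)q^{a_r'}\}\right]_q^{\rm s}.$$ In particular, symplectic SO and symplectic DC codes with these parameters exist. -/

import Mathlib

/-! Codes with coordinates indexed by a finite type `ι` are subspaces of `ι → F`.
A code of length `2n` is a subspace of `ι ⊕ ι → F` with `n = |ι|`: the coordinate `Sum.inl i` is the
`i`-th and `Sum.inr i` the `(n+i)`-th. -/

section Codes

variable {F : Type*} [Field F] {ι : Type*} [Fintype ι]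

/-- The Euclidean dual code `{y | ∀ x ∈ C, ∑ i, x i * y i = 0}`. -/
def euclideanDual (C : Submodule F (ι → F)) : Submodule F (ι → F) where
  carrier := {y | ∀ x ∈ C, ∑ i, x i * y i = 0}
  zero_mem' := by intro x _; simp
  add_mem' := by
    intro y z hy hz x hx
    simp only [Pi.add_apply, mul_add, Finset.sum_add_distrib, hy x hx, hz x hx, add_zero]
  smul_mem' := by
    intro c y hy x hx
    simp only [Pi.smul_apply, smul_eq_mul, mul_left_comm _ c, ← Finset.mul_sum, hy x hx, mul_zero]

/-- The symplectic inner product `∑ i, (x_i y_{n+i} - x_{n+i} y_i)`. -/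
def symplecticInner (x y : ι ⊕ ι → F) : F :=
  ∑ i, (x (Sum.inl i) * y (Sum.inr i) - x (Sum.inr i) * y (Sum.inl i))

/-- The symplectic dual code `{y | ∀ x ∈ C, ⟨x, y⟩_s = 0}`. -/
def symplecticDual (C : Submodule F (ι ⊕ ι → F)) : Submodule F (ι ⊕ ι → F) where
  carrier := {y | ∀ x ∈ C, symplecticInner x y = 0}
  zero_mem' := by intro x _; simp [symplecticInner]
  add_mem' := by
    intro y z hy hz x hx
    have h : symplecticInner x (y + z) = symplecticInner x y + symplecticInner x z := by
      simp only [symplecticInner, Pi.add_apply, ← Finset.sum_add_distrib]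
      exact Finset.sum_congr rfl fun i _ => by ring
    rw [h, hy x hx, hz x hx, add_zero]
  smul_mem' := by
    intro c y hy x hx
    have h : symplecticInner x (c • y) = c * symplecticInner x y := by
      simp only [symplecticInner, Pi.smul_apply, smul_eq_mul, Finset.mul_sum]
      exact Finset.sum_congr rfl fun i _ => by ring
    rw [h, hy x hx, mul_zero]

/-- Symplectic self-orthogonal codes. -/
def IsSymplecticSO (C : Submodule F (ι ⊕ ι → F)) : Prop := C ≤ symplecticDual C

/-- Symplectic dual-containing codes. -/
def IsSymplecticDC (C : Submodule F (ι ⊕ ι → F)) : Prop := symplecticDual C ≤ C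

/-- The symplectic weight: the number of `i` with `(x_i, x_{n+i}) ≠ (0, 0)`. -/
noncomputable def symplecticWeight (x : ι ⊕ ι → F) : ℕ :=
  Set.ncard {i : ι | (x (Sum.inl i), x (Sum.inr i)) ≠ (0, 0)}

/-- `C` is a code of length `N` and dimension `k` whose minimum symplectic distance (the least
symplectic weight of a nonzero codeword) is `d`. -/
def HasSymplecticParams (C : Submodule F (ι ⊕ ι → F)) (N : ℕ) (k : ℤ) (d : ℕ) : Prop :=
  Fintype.card (ι ⊕ ι) = N ∧ (Module.finrank F C : ℤ) = k ∧
    IsLeast {w : ℕ | ∃ x ∈ C, x ≠ 0 ∧ symplecticWeight x = w} d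

end Codes

/-- The Plotkin sum `{(u, u + v) | u ∈ C₁, v ∈ C₂}`. -/
def plotkinSum {F : Type*} [Field F] {ι : Type*} (C₁ C₂ : Submodule F (ι → F)) :
    Submodule F (ι ⊕ ι → F) where
  carrier := {x | ∃ u ∈ C₁, ∃ v ∈ C₂, x = Sum.elim u (u + v)}
  zero_mem' := ⟨0, C₁.zero_mem, 0, C₂.zero_mem, by ext (i | i) <;> simp⟩
  add_mem' := by
    rintro _ _ ⟨u, hu, v, hv, rfl⟩ ⟨u', hu', v', hv', rfl⟩
    refine ⟨u + u', C₁.add_mem hu hu', v + v', C₂.add_mem hv hv', ?_⟩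
    ext (i | i)
    · simp
    · simp only [Pi.add_apply, Sum.elim_inr]
      ring
  smul_mem' := by
    rintro c _ ⟨u, hu, v, hv, rfl⟩
    refine ⟨c • u, C₁.smul_mem c hu, c • v, C₂.smul_mem c hv, ?_⟩
    ext (i | i) <;> simp [mul_add]

/-- The `r`-th order generalized Reed–Muller code: the evaluation vectors at all points of `F^m`
of the polynomials of total degree at most `r` and of degree less than `q = |F|` in each variable.
The coordinates are indexed by the points themselves. -/
noncomputable def GRM (F : Type*) [Field F] [Fintype F] (r m : ℕ) :
    Submodule F ((Fin m → F) → F) :=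
  (MvPolynomial.restrictTotalDegree (Fin m) F r ⊓
    MvPolynomial.restrictDegree (Fin m) F (Fintype.card F - 1)).map
      (MvPolynomial.evalₗ F (Fin m))

/-- The binomial coefficient with integer entries, equal to `0` if the lower entry is negative. -/
noncomputable def intBinom (a b : ℤ) : ℤ :=
  if 0 ≤ b then Ring.choose a b.toNat else 0

/-! In the coordinates (u, u + v) the symplectic form becomes u·v' - v·u', so the symplectic dual of
P(C₁, C₂) is P(C₂^⊥, C₁^⊥) (`symplecticDual_plotkinSum`), and the symplectic weight is the size of
supp u ∪ supp v. Self-orthogonality thus reduces to C₁ ⊆ C₂^⊥, dimensions add, and the minimum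
distance is the smaller of the two Hamming distances.

Three facts on Reed–Muller codes remain. The distance bound is an induction on the number of
variables (`MvPolynomial.grmDist_le_card_eval_ne_zero`), attained by products of linear factors. The
bound also makes evaluation injective on reduced polynomials, so the dimension counts reduced
monomials, which a generating function evaluates. Duality is one inclusion by degree, made an
equality by a dimension count (`GRM_eq_euclideanDual`). -/

/-! ### Arithmetic of the minimum distance -/

/-- The least number of nonzeros of a nonzero reduced polynomial in `m` variables over a field with
`q` elements whose total degree is `m * (q - 1) - s`. -/
def grmDist (q s : ℕ) : ℕ := (s % (q - 1) + 1) * q ^ (s / (q - 1))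

theorem grmDist_mul_add {q a b : ℕ} (hb : b < q - 1) :
    grmDist q (a * (q - 1) + b) = (b + 1) * q ^ a := by
  have h : (a * (q - 1) + b) / (q - 1) = a := by
    rw [add_comm, Nat.add_mul_div_right _ _ (by omega), Nat.div_eq_of_lt hb, zero_add]
  rw [grmDist, h, add_comm (a * _), Nat.add_mul_mod_self_right, Nat.mod_eq_of_lt hb]

theorem grmDist_zero (q : ℕ) : grmDist q 0 = 1 := by simp [grmDist]

/-- The inductive step of the distance bound: c + 1 is the number of nonzeros guaranteed on a line
by degree q - 1 - c. -/
theorem grmDist_add_le {q : ℕ} (hq : 2 ≤ q) (s : ℕ) {c : ℕ} (hc : c ≤ q - 1) :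
    grmDist q (s + c) ≤ (c + 1) * grmDist q s := by
  obtain ⟨p, rfl⟩ : ∃ p, q = p + 2 := ⟨q - 2, by omega⟩
  have hb : s % (p + 2 - 1) < p + 2 - 1 := Nat.mod_lt _ (by omega)
  have hs : s = s / (p + 2 - 1) * (p + 2 - 1) + s % (p + 2 - 1) := (Nat.div_add_mod' _ _).symm
  generalize s / (p + 2 - 1) = a at hs
  generalize s % (p + 2 - 1) = b at hs hb
  subst hs
  rw [grmDist_mul_add hb]
  by_cases h : b + c < p + 2 - 1
  · rw [add_assoc, grmDist_mul_add h, ← mul_assoc]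
    gcongr
    nlinarith
  · obtain ⟨e, he⟩ : ∃ e, b + c = p + 1 + e := ⟨b + c - (p + 1), by omega⟩
    have h1 : a * (p + 2 - 1) + b + c = (a + 1) * (p + 2 - 1) + e := by
      rw [add_assoc, he, add_mul, Nat.add_sub_assoc (by omega)]; ring
    by_cases h2 : e < p + 2 - 1
    · rw [h1, grmDist_mul_add h2, pow_succ', ← mul_assoc, ← mul_assoc]
      refine Nat.mul_le_mul_right _ ?_
      -- With β = q - 1 - b and γ = q - 1 - c, the difference (b + 1)(c + 1) - q(e + 1) is exactly
      -- βγ.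
      obtain ⟨β, hβ⟩ : ∃ β, p + 1 = b + β := ⟨p + 1 - b, by omega⟩
      obtain ⟨γ, hγ⟩ : ∃ γ, p + 1 = c + γ := ⟨p + 1 - c, by omega⟩
      have hb' : b = e + γ := by omega
      have hc' : c = e + β := by omega
      have hp : p + 1 = e + γ + β := by omega
      have hp' : p + 2 = e + γ + β + 1 := by omega
      rw [hp', hb', hc']
      nlinarith [Nat.zero_le (β * γ)]
    · omega

theorem grmDist_mono {q : ℕ} (hq : 2 ≤ q) : Monotone (grmDist q) := by
  refine monotone_nat_of_le_succ fun s => ?_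
  have hb : s % (q - 1) < q - 1 := Nat.mod_lt _ (by omega)
  have hs : s = s / (q - 1) * (q - 1) + s % (q - 1) := (Nat.div_add_mod' _ _).symm
  generalize s / (q - 1) = a at hs
  generalize s % (q - 1) = b at hs hb
  subst hs
  rw [grmDist_mul_add hb]
  by_cases h : b + 1 < q - 1
  · rw [add_assoc, grmDist_mul_add h]
    gcongr
    omega
  · have h1 : a * (q - 1) + b + 1 = (a + 1) * (q - 1) + 0 := by
      have : b + 1 = q - 1 := by omega
      rw [add_assoc, this]; ring
    rw [h1, grmDist_mul_add (by omega), pow_succ', zero_add, one_mul]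
    gcongr
    omega

/-! ### Nonzeros of reduced polynomials -/

theorem Polynomial.card_sub_natDegree_le_card_eval_ne_zero {F : Type*} [Field F] [Fintype F]
    [DecidableEq F] {p : Polynomial F} (hp : p ≠ 0) :
    Fintype.card F - p.natDegree ≤ (Finset.univ.filter fun y => p.eval y ≠ 0).card := by
  have h : (Finset.univ.filter fun y => p.eval y = 0).card ≤ p.natDegree := by
    refine le_trans (Finset.card_le_card ?_) (p.roots.toFinset_card_le.trans p.card_roots')
    intro y hy
    simpa [hp] using hy
  have h2 := Finset.card_filter_add_card_filter_not (s := (Finset.univ : Finset F))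
    (fun y => p.eval y = 0)
  rw [Finset.card_univ] at h2
  simp only [ne_eq]
  omega

/-- Expand f in its first variable, with leading coefficient g of degree t in that variable. Over
each nonzero of g, f restricts to a univariate polynomial of degree t, with at least q - t nonzeros;
induction bounds the nonzeros of g. -/
theorem MvPolynomial.grmDist_le_card_eval_ne_zero {F : Type*} [Field F] [Fintype F]
    [DecidableEq F] {m : ℕ} (f : MvPolynomial (Fin m) F) (hf : f ≠ 0)
    (hdeg : ∀ k, f.degreeOf k ≤ Fintype.card F - 1) :
    grmDist (Fintype.card F) (m * (Fintype.card F - 1) - f.totalDegree) ≤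
      (Finset.univ.filter fun x => eval x f ≠ 0).card := by
  have hq : 2 ≤ Fintype.card F := Fintype.one_lt_card
  induction m with
  | zero =>
    rw [zero_mul, Nat.zero_sub, grmDist_zero, Nat.one_le_iff_ne_zero, Finset.card_ne_zero]
    refine ⟨0, Finset.mem_filter.2 ⟨Finset.mem_univ _, fun h => hf ?_⟩⟩
    rw [eq_C_of_isEmpty f, eval_C] at h
    rw [eq_C_of_isEmpty f, h, C_0]
  | succ m ih =>
    set P := finSuccEquiv F m f with hP
    have hP0 : P ≠ 0 := (EmbeddingLike.map_ne_zero_iff (f := finSuccEquiv F m)).2 hf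
    set t := P.natDegree with ht
    have hg : P.coeff t ≠ 0 := by simpa [ht] using hP0
    have htq : t ≤ Fintype.card F - 1 := by
      rw [ht, hP, natDegree_finSuccEquiv]
      exact hdeg 0
    have htd := totalDegree_coeff_finSuccEquiv_add_le f t hg
    rw [← hP] at htd
    have ihg := ih (P.coeff t) hg fun k => (degreeOf_coeff_finSuccEquiv f k t).trans (hdeg _)
    set T := Finset.univ.filter fun x => eval x (P.coeff t) ≠ 0
    have hfib : ∀ s ∈ T, Fintype.card F - t ≤
        ((Finset.univ.filter fun x => eval x f ≠ 0).filter fun x => Fin.tail x = s).card := by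
      intro s hs
      have hs' : (P.map (eval s)).coeff t ≠ 0 := by
        rw [Polynomial.coeff_map]
        exact (Finset.mem_filter.1 hs).2
      have hne : P.map (eval s) ≠ 0 := fun h => hs' (by rw [h, Polynomial.coeff_zero])
      have h1 := Polynomial.card_sub_natDegree_le_card_eval_ne_zero hne
      have h2 : (P.map (eval s)).natDegree ≤ t := Polynomial.natDegree_map_le
      refine le_trans (by omega) (h1.trans (Finset.card_le_card_of_injOn
        (fun y => (Fin.cons y s : Fin (m + 1) → F)) ?_ ?_))
      · intro y hy
        simpa [eval_eq_eval_mv_eval'] using hy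
      · intro y _ z _ h
        simpa using congrFun h 0
    have hsum : T.card * (Fintype.card F - t) ≤
        (Finset.univ.filter fun x => eval x f ≠ 0).card := by
      rw [← smul_eq_mul, Finset.card_eq_sum_card_fiberwise
        (f := (Fin.tail : (Fin (m + 1) → F) → Fin m → F)) (t := Finset.univ) (by simp)]
      exact (Finset.card_nsmul_le_sum _ _ _ hfib).trans
        (Finset.sum_le_sum_of_subset (Finset.subset_univ _))
    refine le_trans ?_ hsum
    have h3 := grmDist_add_le hq (m * (Fintype.card F - 1) - (P.coeff t).totalDegree)
      (c := Fintype.card F - 1 - t) (by omega)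
    have h4 : Fintype.card F - 1 - t + 1 = Fintype.card F - t := by omega
    rw [h4] at h3
    rw [mul_comm T.card]
    -- Since deg g + t ≤ deg f, the defect of f is at most that of g plus q - 1 - t.
    refine le_trans (grmDist_mono hq ?_) (h3.trans (Nat.mul_le_mul_left _ ihg))
    rw [add_mul, one_mul]
    omega

/-- Degrees of an extremal polynomial: for s = a(q - 1) + b, take a zeros, then q - 1 - b, then q -
1 throughout (if a < m). -/
theorem exists_sum_add_eq_prod_sub_eq_grmDist {q : ℕ} (hq : 2 ≤ q) (m s : ℕ)
    (hs : s ≤ m * (q - 1)) :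
    ∃ d : Fin m → ℕ, (∀ k, d k ≤ q - 1) ∧ ∑ k, d k + s = m * (q - 1) ∧
      ∏ k, (q - d k) = grmDist q s := by
  induction m generalizing s with
  | zero =>
    obtain rfl : s = 0 := by simpa using hs
    exact ⟨0, by simp, by simp, by simp [grmDist_zero]⟩
  | succ m ih =>
    have hm : (m + 1) * (q - 1) = m * (q - 1) + (q - 1) := by ring
    by_cases h : s < q - 1
    · refine ⟨Fin.cons (q - 1 - s) fun _ => q - 1, ?_, ?_, ?_⟩
      · exact Fin.cases (by simp) (by simp)
      · rw [Fin.sum_univ_succ]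
        simp
        omega
      · have h1 : q - (q - 1) = 1 := by omega
        have h2 := grmDist_mul_add (a := 0) h
        rw [zero_mul, zero_add, pow_zero, mul_one] at h2
        rw [Fin.prod_univ_succ, h2]
        simp [h1]
        omega
    · obtain ⟨d, hd, hsum, hprod⟩ := ih (s - (q - 1)) (by omega)
      refine ⟨Fin.cons 0 d, Fin.cases (by simp) (by simpa using hd), ?_, ?_⟩
      · rw [Fin.sum_univ_succ]
        simp
        omega
      · rw [Fin.prod_univ_succ]
        simp only [Fin.cons_zero, Fin.cons_succ, hprod, Nat.sub_zero]
        have h1 : s = (s - (q - 1)) + (q - 1) := by omega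
        rw [grmDist, grmDist]
        conv_rhs => rw [h1]
        rw [Nat.add_mod_right, Nat.add_div_right _ (by omega), pow_succ]
        ring

/-! ### Minimum distance of Reed–Muller codes -/

theorem mem_GRM_iff {F : Type*} [Field F] [Fintype F] {r m : ℕ} {c : (Fin m → F) → F} :
    c ∈ GRM F r m ↔ ∃ f : MvPolynomial (Fin m) F, f.totalDegree ≤ r ∧
      (∀ k, f.degreeOf k ≤ Fintype.card F - 1) ∧ ∀ x, MvPolynomial.eval x f = c x := by
  classical
  simp only [GRM, Submodule.mem_map, Submodule.mem_inf, MvPolynomial.mem_restrictTotalDegree,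
    MvPolynomial.mem_restrictDegree_iff_sup, MvPolynomial.degreeOf_def, and_assoc, funext_iff,
    MvPolynomial.evalₗ_apply]

theorem grmDist_le_ncard_support {F : Type*} [Field F] [Fintype F] {r m : ℕ} {c : (Fin m → F) → F}
    (hc : c ∈ GRM F r m) (h0 : c ≠ 0) :
    grmDist (Fintype.card F) (m * (Fintype.card F - 1) - r) ≤ {x | c x ≠ 0}.ncard := by
  classical
  obtain ⟨f, hf, hdeg, hev⟩ := mem_GRM_iff.1 hc
  have hf0 : f ≠ 0 := fun h => h0 (by ext x; simp [← hev, h])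
  have := f.grmDist_le_card_eval_ne_zero hf0 hdeg
  simp only [hev] at this
  rw [Set.ncard_eq_toFinset_card', Set.toFinset_ofPred]
  exact (grmDist_mono Fintype.one_lt_card (by omega)).trans this

theorem exists_mem_GRM_ncard_support_eq {F : Type*} [Field F] [Fintype F] {r m : ℕ}
    (hr : r ≤ m * (Fintype.card F - 1)) : ∃ c ∈ GRM F r m,
      {x | c x ≠ 0}.ncard = grmDist (Fintype.card F) (m * (Fintype.card F - 1) - r) := by
  classical
  obtain ⟨d, hd, hsum, hprod⟩ := exists_sum_add_eq_prod_sub_eq_grmDist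
    (Fintype.one_lt_card (α := F)) m (m * (Fintype.card F - 1) - r) (by omega)
  have hS : ∀ k, ∃ S : Finset F, S.card = d k := fun k =>
    (Finset.exists_subset_card_eq (s := (Finset.univ : Finset F))
      ((hd k).trans (by rw [Finset.card_univ]; omega))).imp fun _ h => h.2
  choose S hS using hS
  refine ⟨_, mem_GRM_iff.2 ⟨∏ k, ∏ a ∈ S k, (MvPolynomial.X k - MvPolynomial.C a), ?_, ?_,
    fun x => rfl⟩, ?_⟩
  · refine (MvPolynomial.totalDegree_finsetProd _ _).trans ?_
    have : ∑ k, d k ≤ r := by omega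
    refine le_trans (Finset.sum_le_sum fun k _ => ?_) this
    refine (MvPolynomial.totalDegree_finsetProd _ _).trans ?_
    rw [← hS k, Finset.card_eq_sum_ones]
    exact Finset.sum_le_sum fun a _ => (MvPolynomial.totalDegree_sub_C_le _ _).trans (by simp)
  · intro k
    refine (MvPolynomial.degreeOf_prod_le _ _ _).trans ?_
    refine le_trans (Finset.sum_le_sum (g := fun j => if j = k then d k else 0) fun j _ => ?_)
      (by simpa using hd k)
    refine (MvPolynomial.degreeOf_prod_le _ _ _).trans ?_
    have hX : ∀ a : F, (MvPolynomial.X j - MvPolynomial.C a).degreeOf k ≤ if j = k then 1 else 0 := by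
      intro a
      refine (MvPolynomial.degreeOf_sub_le _ _ _).trans ?_
      simp [MvPolynomial.degreeOf_X, MvPolynomial.degreeOf_C, eq_comm]
    refine (Finset.sum_le_sum fun a _ => hX a).trans ?_
    split_ifs with h
    · simp [← h, hS]
    · simp
  -- The nonzeros form the box of points avoiding S k in each coordinate k.
  · have h1 : {x : Fin m → F | MvPolynomial.eval x (∏ k, ∏ a ∈ S k, (MvPolynomial.X k -
        MvPolynomial.C a)) ≠ 0} = ↑(Fintype.piFinset fun k => (S k)ᶜ) := by
      ext x
      simp only [map_prod, map_sub, MvPolynomial.eval_X, MvPolynomial.eval_C, Set.mem_ofPred_eq,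
        Finset.prod_ne_zero_iff, Finset.mem_coe, Fintype.mem_piFinset, Finset.mem_univ,
        sub_ne_zero, Finset.mem_compl, forall_const]
      exact forall_congr' fun k => ⟨fun h h' => h _ h' rfl, fun h a ha h' => h (h' ▸ ha)⟩
    rw [h1, Set.ncard_coe_finset, Fintype.card_piFinset, ← hprod]
    simp [Finset.card_compl, hS]

/-! ### Dimension of Reed–Muller codes -/

open PowerSeries in
-- Compare coefficients in (1 + ⋯ + X^(q-1))^m / (1 - X) = (1 - X^q)^m / (1 - X)^(m+1); the factor
-- 1/(1 - X) turns "sum equal to r" into "sum at most r".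
theorem card_filter_sum_le_eq_sum_intBinom (m q r : ℕ) :
    (((Fintype.piFinset fun _ : Fin m => Finset.range q).filter fun e => ∑ k, e k ≤ r).card : ℤ) =
      ∑ j ∈ Finset.range (m + 1), (-1 : ℤ) ^ j * (m.choose j : ℤ) *
        intBinom (m + r - j * q) (r - j * q) := by
  set A : ℤ⟦X⟧ := ∑ k ∈ Finset.range q, X ^ k
  set B : ℤ⟦X⟧ := PowerSeries.mk fun n => ((m + n).choose m : ℤ)
  have hA : A * (1 - X) = 1 - X ^ q := geom_sum_mul_neg _ _
  have hB : B * (1 - X) ^ (m + 1) = 1 := mk_add_choose_mul_one_sub_pow_eq_one ℤ m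
  have h1 : (PowerSeries.mk 1 : ℤ⟦X⟧) * (1 - X) = 1 := mk_one_mul_one_sub_eq_one ℤ
  have key : A ^ m * PowerSeries.mk 1 = (1 - X ^ q) ^ m * B := by
    calc A ^ m * PowerSeries.mk 1 = A ^ m * PowerSeries.mk 1 * (B * (1 - X) ^ (m + 1)) := by
          rw [hB, mul_one]
      _ = (A * (1 - X)) ^ m * (PowerSeries.mk 1 * (1 - X)) * B := by
          rw [mul_pow, pow_succ]; ring
      _ = _ := by rw [hA, h1, mul_one]
  have hl : coeff r (A ^ m * PowerSeries.mk 1) =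
      (((Fintype.piFinset fun _ : Fin m => Finset.range q).filter
        fun e => ∑ k, e k ≤ r).card : ℤ) := by
    have hAm : A ^ m = ∏ _k : Fin m, A := by simp
    rw [hAm, Finset.prod_univ_sum, Finset.sum_mul, map_sum, Finset.card_filter, Nat.cast_sum]
    refine Finset.sum_congr rfl fun e _ => ?_
    rw [Finset.prod_pow_eq_pow_sum, coeff_X_pow_mul']
    simp
  have hr : coeff r ((1 - X ^ q) ^ m * B) = ∑ j ∈ Finset.range (m + 1), (-1 : ℤ) ^ j *
      (m.choose j : ℤ) * intBinom (m + r - j * q) (r - j * q) := by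
    rw [sub_eq_add_neg, add_comm, add_pow, Finset.sum_mul, map_sum]
    refine Finset.sum_congr rfl fun j _ => ?_
    have h2 : (-X ^ q : ℤ⟦X⟧) ^ j * 1 ^ (m - j) * (m.choose j : ℤ⟦X⟧) * B =
        C ((-1 : ℤ) ^ j * (m.choose j : ℤ)) * (X ^ (q * j) * B) := by
      rw [neg_pow, one_pow, ← pow_mul]
      simp only [map_mul, map_pow, map_neg, map_one, map_natCast]
      ring
    rw [h2, coeff_C_mul, coeff_X_pow_mul', intBinom]
    congr 1
    by_cases h : q * j ≤ r
    · have h3 : ((r : ℤ) - j * q) = ((r - q * j : ℕ) : ℤ) := by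
        rw [Nat.cast_sub h]; push_cast; ring
      have h4 : ((m : ℤ) + r - j * q) = ((m + (r - q * j) : ℕ) : ℤ) := by
        rw [add_sub_assoc, h3, Nat.cast_add]
      rw [if_pos h, h3, h4, if_pos (Int.natCast_nonneg _), Int.toNat_natCast, Ring.choose_natCast,
        coeff_mk, Nat.choose_symm_add]
    · have h3 : ¬ (0 : ℤ) ≤ r - j * q := by
        rw [sub_nonneg, mul_comm]
        exact_mod_cast h
      rw [if_neg h, if_neg h3]
  rw [← hl, key, hr]

theorem finrank_GRM {F : Type*} [Field F] [Fintype F] (r m : ℕ) :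
    Module.finrank F (GRM F r m) = ((Fintype.piFinset fun _ : Fin m =>
      Finset.range (Fintype.card F)).filter fun e => ∑ k, e k ≤ r).card := by
  classical
  have hq : 2 ≤ Fintype.card F := Fintype.one_lt_card
  set S : Set (Fin m →₀ ℕ) :=
    {n | (n.sum fun _ e => e) ≤ r} ∩ {n | ∀ k, n k ≤ Fintype.card F - 1} with hS
  set W := MvPolynomial.restrictTotalDegree (Fin m) F r ⊓
    MvPolynomial.restrictDegree (Fin m) F (Fintype.card F - 1) with hW
  have hWS : W = MvPolynomial.restrictSupport F S := by
    ext p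
    simp only [hW, hS, Submodule.mem_inf, MvPolynomial.restrictTotalDegree,
      MvPolynomial.restrictDegree, MvPolynomial.mem_restrictSupport_iff, Set.subset_inter_iff]
  have hinj : Function.Injective ((MvPolynomial.evalₗ F (Fin m)).domRestrict W) := by
    rw [← LinearMap.ker_eq_bot, LinearMap.ker_eq_bot']
    rintro ⟨f, hf⟩ h
    by_contra h0
    have hf0 : f ≠ 0 := fun h' => h0 (Subtype.ext h')
    have hd : ∀ k, f.degreeOf k ≤ Fintype.card F - 1 := by
      have := hf.2
      rw [SetLike.mem_coe, MvPolynomial.mem_restrictDegree_iff_sup] at this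
      simpa [MvPolynomial.degreeOf_def] using this
    have h1 := f.grmDist_le_card_eval_ne_zero hf0 hd
    have h2 : ∀ x, MvPolynomial.eval x f = 0 := fun x => congrFun h x
    simp only [h2, ne_eq, not_true_eq_false, Finset.filter_false, Finset.card_empty] at h1
    -- A nonzero reduced polynomial has at least `grmDist q 0 = 1` nonzeros, so it cannot evaluate
    -- to zero everywhere.
    have h3 := (grmDist_mono hq (Nat.zero_le _)).trans h1
    rw [grmDist_zero] at h3
    omega
  have hrange : GRM F r m = LinearMap.range ((MvPolynomial.evalₗ F (Fin m)).domRestrict W) := by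
    rw [LinearMap.range_domRestrict, GRM]
  rw [hrange, LinearMap.finrank_range_of_inj hinj, hWS,
    Module.finrank_eq_nat_card_basis (MvPolynomial.basisRestrictSupport F S), ← Set.ncard_coe_finset]
  refine Nat.card_congr (Finsupp.equivFunOnFinite.subtypeEquiv fun n => ?_)
  simp only [hS, Set.mem_inter_iff, Set.mem_ofPred_eq, Finset.coe_filter, Fintype.mem_piFinset,
    Finset.mem_range, Finsupp.equivFunOnFinite_apply]
  rw [and_comm, Finsupp.sum_fintype _ _ fun _ => rfl]
  refine and_congr_left fun _ => forall_congr' fun k => ?_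
  omega

theorem finrank_GRM_eq_sum_intBinom {F : Type*} [Field F] [Fintype F] (r m : ℕ) :
    (Module.finrank F (GRM F r m) : ℤ) =
      ∑ j ∈ Finset.range (m + 1), (-1 : ℤ) ^ j * (m.choose j : ℤ) *
        intBinom (m + r - j * Fintype.card F) (r - j * Fintype.card F) := by
  rw [finrank_GRM, card_filter_sum_le_eq_sum_intBinom]

/-- The reflection e ↦ q - 1 - e exchanges sum > r with sum ≤ s. -/
theorem card_filter_sum_le_add_card_filter_sum_le {m q r s : ℕ} (h : r + s + 1 = m * (q - 1)) :
    ((Fintype.piFinset fun _ : Fin m => Finset.range q).filter fun e => ∑ k, e k ≤ r).card +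
      ((Fintype.piFinset fun _ : Fin m => Finset.range q).filter fun e => ∑ k, e k ≤ s).card =
        q ^ m := by
  have hcard : (Fintype.piFinset fun _ : Fin m => Finset.range q).card = q ^ m := by simp
  rw [← hcard, ← Finset.card_filter_add_card_filter_not
    (s := Fintype.piFinset fun _ : Fin m => Finset.range q) (fun e : Fin m → ℕ => ∑ k, e k ≤ r)]
  congr 1
  have hsum : ∀ e : Fin m → ℕ, e ∈ (Fintype.piFinset fun _ : Fin m => Finset.range q) →
      ∑ k, (q - 1 - e k) + ∑ k, e k = m * (q - 1) := by
    intro e he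
    rw [← Finset.sum_add_distrib]
    simp only [Fintype.mem_piFinset, Finset.mem_range] at he
    rw [Finset.sum_congr rfl fun k _ => Nat.sub_add_cancel (Nat.le_sub_one_of_lt (he k))]
    simp
  have hmem : ∀ e : Fin m → ℕ, e ∈ (Fintype.piFinset fun _ : Fin m => Finset.range q) →
      (fun k => q - 1 - e k) ∈ (Fintype.piFinset fun _ : Fin m => Finset.range q) := by
    intro e he
    simp only [Fintype.mem_piFinset, Finset.mem_range] at he ⊢
    intro k
    have := he k
    omega
  have hinv : ∀ e : Fin m → ℕ, e ∈ (Fintype.piFinset fun _ : Fin m => Finset.range q) →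
      (fun k => q - 1 - (q - 1 - e k)) = e := by
    intro e he
    simp only [Fintype.mem_piFinset, Finset.mem_range] at he
    ext k
    have := he k
    omega
  refine Finset.card_nbij' (fun (e : Fin m → ℕ) k => q - 1 - e k)
    (fun (e : Fin m → ℕ) k => q - 1 - e k) ?_ ?_ ?_ ?_
  · intro e he
    simp only [Finset.coe_filter, Set.mem_ofPred_eq] at he ⊢
    have := hsum e he.1
    exact ⟨hmem e he.1, by omega⟩
  · intro e he
    simp only [Finset.coe_filter, Set.mem_ofPred_eq] at he ⊢
    have := hsum e he.1
    exact ⟨hmem e he.1, by omega⟩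
  · exact fun e he => hinv e (Finset.mem_filter.1 he).1
  · exact fun e he => hinv e (Finset.mem_filter.1 he).1

/-! ### Plotkin sums and the symplectic form -/

section Codes

variable {F : Type*} [Field F] {ι : Type*}

theorem euclideanDual_eq_comap [Fintype ι] [DecidableEq ι] (C : Submodule F (ι → F)) :
    euclideanDual C = C.dualAnnihilator.comap (dotProductEquiv F ι).toLinearMap := by
  ext y
  simp only [Submodule.mem_comap, Submodule.mem_dualAnnihilator]
  exact forall₂_congr fun x _ => by
    simp [dotProduct, mul_comm]

theorem finrank_add_finrank_euclideanDual [Fintype ι] (C : Submodule F (ι → F)) :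
    Module.finrank F C + Module.finrank F (euclideanDual C) = Fintype.card ι := by
  classical
  rw [euclideanDual_eq_comap, Submodule.comap_equiv_eq_map_symm, LinearEquiv.finrank_map_eq, Subspace.finrank_add_finrank_dualAnnihilator_eq,
    Module.finrank_fintype_fun_eq_card]

theorem symplecticDual_anti [Fintype ι] {C D : Submodule F (ι ⊕ ι → F)} (h : C ≤ D) :
    symplecticDual D ≤ symplecticDual C := fun _ hy x hx => hy x (h hx)

theorem IsSymplecticSO.symplecticDual [Fintype ι] {C : Submodule F (ι ⊕ ι → F)} (h : IsSymplecticSO C) :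
    IsSymplecticDC (symplecticDual C) := symplecticDual_anti h

theorem symplecticInner_elim [Fintype ι] (u v u' v' : ι → F) :
    symplecticInner (Sum.elim u (u + v)) (Sum.elim u' (u' + v')) =
      ∑ k, u k * v' k - ∑ k, v k * u' k := by
  rw [symplecticInner, ← Finset.sum_sub_distrib]
  refine Finset.sum_congr rfl fun k _ => ?_
  simp only [Sum.elim_inl, Sum.elim_inr, Pi.add_apply]
  ring

theorem exists_eq_elim_add (x : ι ⊕ ι → F) : ∃ u v : ι → F, x = Sum.elim u (u + v) :=
  ⟨x ∘ Sum.inl, x ∘ Sum.inr - x ∘ Sum.inl, by ext (k | k) <;> simp⟩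

theorem elim_add_inj {u v u' v' : ι → F} :
    Sum.elim u (u + v) = Sum.elim u' (u' + v') ↔ u = u' ∧ v = v' := by
  rw [Sum.elim_eq_iff]
  constructor
  · rintro ⟨rfl, h⟩
    exact ⟨rfl, add_left_cancel h⟩
  · rintro ⟨rfl, rfl⟩
    exact ⟨rfl, rfl⟩

theorem elim_add_mem_plotkinSum {C₁ C₂ : Submodule F (ι → F)} {u v : ι → F} :
    Sum.elim u (u + v) ∈ plotkinSum C₁ C₂ ↔ u ∈ C₁ ∧ v ∈ C₂ := by
  constructor
  · rintro ⟨u', hu', v', hv', h⟩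
    obtain ⟨rfl, rfl⟩ := elim_add_inj.1 h
    exact ⟨hu', hv'⟩
  · exact fun h => ⟨u, h.1, v, h.2, rfl⟩

theorem plotkinSum_mono {C₁ C₂ D₁ D₂ : Submodule F (ι → F)} (h₁ : C₁ ≤ D₁) (h₂ : C₂ ≤ D₂) :
    plotkinSum C₁ C₂ ≤ plotkinSum D₁ D₂ := by
  rintro _ ⟨u, hu, v, hv, rfl⟩
  exact ⟨u, h₁ hu, v, h₂ hv, rfl⟩

/-- Testing against (0, v) and (u, u) separates the two orthogonality conditions. -/
theorem symplecticDual_plotkinSum [Fintype ι] (C₁ C₂ : Submodule F (ι → F)) :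
    symplecticDual (plotkinSum C₁ C₂) = plotkinSum (euclideanDual C₂) (euclideanDual C₁) := by
  ext y
  obtain ⟨u', v', rfl⟩ := exists_eq_elim_add y
  rw [elim_add_mem_plotkinSum]
  constructor
  · intro h
    refine ⟨fun v hv => ?_, fun u hu => ?_⟩
    · have := h _ (elim_add_mem_plotkinSum.2 ⟨C₁.zero_mem, hv⟩)
      rw [symplecticInner_elim] at this
      simpa using this
    · have := h _ (elim_add_mem_plotkinSum.2 ⟨hu, C₂.zero_mem⟩)
      rw [symplecticInner_elim] at this
      simpa using this
  · rintro ⟨h₂, h₁⟩ _ ⟨u, hu, v, hv, rfl⟩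
    rw [symplecticInner_elim, h₁ u hu, h₂ v hv, sub_zero]

theorem finrank_plotkinSum [Finite ι] (C₁ C₂ : Submodule F (ι → F)) :
    Module.finrank F (plotkinSum C₁ C₂) = Module.finrank F C₁ + Module.finrank F C₂ := by
  rw [← Module.finrank_prod]
  refine (LinearEquiv.ofBijective
    ({ toFun := fun p => ⟨Sum.elim p.1 (p.1 + p.2), p.1, p.1.2, p.2, p.2.2, rfl⟩
       map_add' := ?_
       map_smul' := ?_ } : (C₁ × C₂) →ₗ[F] plotkinSum C₁ C₂) ⟨?_, ?_⟩).finrank_eq.symm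
  · intro p p'
    ext (k | k)
    · simp
    · simp only [Prod.fst_add, Prod.snd_add, Submodule.coe_add, Sum.elim_inr, Pi.add_apply]
      ring
  · intro c p
    ext (k | k) <;> simp [mul_add]
  · rintro ⟨⟨u, hu⟩, ⟨v, hv⟩⟩ ⟨⟨u', hu'⟩, ⟨v', hv'⟩⟩ h
    obtain ⟨rfl, rfl⟩ := elim_add_inj.1 (Subtype.ext_iff.1 h)
    rfl
  · rintro ⟨_, u, hu, v, hv, rfl⟩
    exact ⟨⟨⟨u, hu⟩, ⟨v, hv⟩⟩, rfl⟩

theorem symplecticWeight_elim (u v : ι → F) :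
    symplecticWeight (Sum.elim u (u + v)) = ({k | u k ≠ 0} ∪ {k | v k ≠ 0}).ncard := by
  rw [symplecticWeight]
  congr 1
  ext k
  by_cases h : u k = 0 <;> simp [h]

/-- The words (c, c) and (0, c) attain d₁ and d₂; conversely the union of supports contains each
support. -/
theorem isLeast_symplecticWeight_plotkinSum [Fintype ι] {C₁ C₂ : Submodule F (ι → F)}
    {d₁ d₂ : ℕ}
    (h₁ : IsLeast {w | ∃ c ∈ C₁, c ≠ 0 ∧ {k | c k ≠ 0}.ncard = w} d₁)
    (h₂ : IsLeast {w | ∃ c ∈ C₂, c ≠ 0 ∧ {k | c k ≠ 0}.ncard = w} d₂) :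
    IsLeast {w | ∃ x ∈ plotkinSum C₁ C₂, x ≠ 0 ∧ symplecticWeight x = w} (min d₁ d₂) := by
  have hne : ∀ {u v : ι → F}, Sum.elim u (u + v) = 0 ↔ u = 0 ∧ v = 0 := by
    intro u v
    rw [← elim_add_inj, add_zero, Sum.elim_zero_zero]
  constructor
  · rcases min_choice d₁ d₂ with h | h <;> rw [h]
    · obtain ⟨c, hc, hc0, hw⟩ := h₁.1
      refine ⟨_, elim_add_mem_plotkinSum.2 ⟨hc, C₂.zero_mem⟩, fun h => hc0 (hne.1 h).1, ?_⟩
      rw [symplecticWeight_elim, ← hw]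
      simp
    · obtain ⟨c, hc, hc0, hw⟩ := h₂.1
      refine ⟨_, elim_add_mem_plotkinSum.2 ⟨C₁.zero_mem, hc⟩, fun h => hc0 (hne.1 h).2, ?_⟩
      rw [symplecticWeight_elim, ← hw]
      simp
  · rintro _ ⟨_, ⟨u, hu, v, hv, rfl⟩, h0, rfl⟩
    rw [symplecticWeight_elim]
    by_cases hu0 : u = 0
    · have hv0 : v ≠ 0 := fun h => h0 (hne.2 ⟨hu0, h⟩)
      exact (min_le_right _ _).trans ((h₂.2 ⟨v, hv, hv0, rfl⟩).trans
        (Set.ncard_le_ncard Set.subset_union_right (Set.toFinite _)))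
    · exact (min_le_left _ _).trans ((h₁.2 ⟨u, hu, hu0, rfl⟩).trans
        (Set.ncard_le_ncard Set.subset_union_left (Set.toFinite _)))

end Codes

/-! ### Duality of Reed–Muller codes and the main theorem -/

theorem GRM_mono {F : Type*} [Field F] [Fintype F] {r s : ℕ} (m : ℕ) (h : r ≤ s) :
    GRM F r m ≤ GRM F s m := by
  intro c hc
  obtain ⟨f, hf, hf'⟩ := mem_GRM_iff.1 hc
  exact mem_GRM_iff.2 ⟨f, hf.trans h, hf'⟩

/-- A product fg has degree below m(q - 1), so its values sum to zero over F^m; complementary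
dimensions then force equality. -/
theorem GRM_eq_euclideanDual {F : Type*} [Field F] [Fintype F] {r s m : ℕ}
    (h : r + s + 1 = m * (Fintype.card F - 1)) : GRM F s m = euclideanDual (GRM F r m) := by
  classical
  refine Submodule.eq_of_le_of_finrank_eq ?_ ?_
  · intro y hy x hx
    obtain ⟨f, hf, -, hfx⟩ := mem_GRM_iff.1 hx
    obtain ⟨g, hg, -, hgy⟩ := mem_GRM_iff.1 hy
    simp only [← hfx, ← hgy, ← map_mul]
    refine MvPolynomial.sum_eval_eq_zero _ ?_
    have := MvPolynomial.totalDegree_mul f g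
    rw [Fintype.card_fin, mul_comm _ m]
    omega
  · have h1 := finrank_add_finrank_euclideanDual (GRM F r m)
    have h2 := card_filter_sum_le_add_card_filter_sum_le h
    rw [← finrank_GRM, ← finrank_GRM] at h2
    rw [Fintype.card_pi_const] at h1
    omega

theorem isLeast_ncard_support_GRM {F : Type*} [Field F] [Fintype F] {r m : ℕ}
    (hr : r ≤ m * (Fintype.card F - 1)) :
    IsLeast {w | ∃ c ∈ GRM F r m, c ≠ 0 ∧ {k | c k ≠ 0}.ncard = w}
      (grmDist (Fintype.card F) (m * (Fintype.card F - 1) - r)) := by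
  constructor
  · obtain ⟨c, hc, hw⟩ := exists_mem_GRM_ncard_support_eq hr
    refine ⟨c, hc, ?_, hw⟩
    rintro rfl
    have h := grmDist_mono (Fintype.one_lt_card (α := F)) (Nat.zero_le _) |>.trans_eq hw.symm
    rw [grmDist_zero] at h
    simp at h
  · rintro _ ⟨c, hc, h0, rfl⟩
    exact grmDist_le_ncard_support hc h0
theorem mainTheorem5 {F : Type*} [Field F] [Fintype F] (q : ℕ) (hq : Fintype.card F = q)
    (r i m : ℕ) (hr : r < m * (q - 1)) (hi : i ≤ m * (q - 1) - r - 1)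
    (a_r b_r a_i b_i a_r' b_r' a_i' b_i' : ℕ)
    (h_r : m * (q - 1) - r = a_r * (q - 1) + b_r) (hb_r : b_r < q - 1)
    (h_i : m * (q - 1) - i = a_i * (q - 1) + b_i) (hb_i : b_i < q - 1)
    (h_r' : r + 1 = a_r' * (q - 1) + b_r') (hb_r' : b_r' < q - 1)
    (h_i' : i + 1 = a_i' * (q - 1) + b_i') (hb_i' : b_i' < q - 1) :
    (GRM F i m ≤ GRM F (m * (q - 1) - r - 1) m ∧
      GRM F (m * (q - 1) - r - 1) m = euclideanDual (GRM F r m)) ∧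
    (IsSymplecticSO (plotkinSum (GRM F i m) (GRM F r m)) ∧
      HasSymplecticParams (plotkinSum (GRM F i m) (GRM F r m))
        (2 * q ^ m)
        (∑ j ∈ Finset.range (m + 1), (-1 : ℤ) ^ j * (m.choose j : ℤ) *
          (intBinom (m + i - j * q) (i - j * q) + intBinom (m + r - j * q) (r - j * q)))
        (min ((b_i + 1) * q ^ a_i) ((b_r + 1) * q ^ a_r))) ∧
    (IsSymplecticDC (symplecticDual (plotkinSum (GRM F i m) (GRM F r m))) ∧
      HasSymplecticParams (symplecticDual (plotkinSum (GRM F i m) (GRM F r m)))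
        (2 * q ^ m)
        (2 * (q : ℤ) ^ m - ∑ j ∈ Finset.range (m + 1), (-1 : ℤ) ^ j * (m.choose j : ℤ) *
          (intBinom (m + i - j * q) (i - j * q) + intBinom (m + r - j * q) (r - j * q)))
        (min ((b_i' + 1) * q ^ a_i') ((b_r' + 1) * q ^ a_r'))) := by
  subst hq
  rw [GRM_eq_euclideanDual (r := r) (s := m * (Fintype.card F - 1) - r - 1) (by omega)]
  have hle : GRM F i m ≤ euclideanDual (GRM F r m) := by
    rw [← GRM_eq_euclideanDual (r := r) (s := m * (Fintype.card F - 1) - r - 1) (by omega)]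
    exact GRM_mono m hi
  have hle' : GRM F r m ≤ euclideanDual (GRM F i m) := by
    rw [← GRM_eq_euclideanDual (r := i) (s := m * (Fintype.card F - 1) - i - 1) (by omega)]
    exact GRM_mono m (by omega)
  have hSO : IsSymplecticSO (plotkinSum (GRM F i m) (GRM F r m)) := by
    rw [IsSymplecticSO, symplecticDual_plotkinSum]
    exact plotkinSum_mono hle hle'
  have hlen : Fintype.card ((Fin m → F) ⊕ (Fin m → F)) = 2 * Fintype.card F ^ m := by
    classical
    rw [Fintype.card_sum, Fintype.card_pi_const, two_mul]
  have hK : (Module.finrank F (GRM F i m) : ℤ) + Module.finrank F (GRM F r m) =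
      ∑ j ∈ Finset.range (m + 1), (-1 : ℤ) ^ j * (m.choose j : ℤ) *
        (intBinom (m + i - j * Fintype.card F) (i - j * Fintype.card F) +
          intBinom (m + r - j * Fintype.card F) (r - j * Fintype.card F)) := by
    rw [finrank_GRM_eq_sum_intBinom, finrank_GRM_eq_sum_intBinom, ← Finset.sum_add_distrib]
    exact Finset.sum_congr rfl fun j _ => by ring
  refine ⟨⟨hle, rfl⟩, ⟨hSO, hlen, ?_, ?_⟩, hSO.symplecticDual, hlen, ?_, ?_⟩
  · rw [finrank_plotkinSum, Nat.cast_add, hK]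
  · rw [← grmDist_mul_add hb_i, ← grmDist_mul_add hb_r, ← h_i, ← h_r]
    exact isLeast_symplecticWeight_plotkinSum (isLeast_ncard_support_GRM (by omega))
      (isLeast_ncard_support_GRM (by omega))
  · classical
    have h1 := finrank_add_finrank_euclideanDual (GRM F i m)
    have h2 := finrank_add_finrank_euclideanDual (GRM F r m)
    rw [Fintype.card_pi_const] at h1 h2
    rw [symplecticDual_plotkinSum, finrank_plotkinSum, ← hK]
    zify at h1 h2
    push_cast
    linarith
  -- Duality swaps the two summands, hence `min_comm`; the dual of order r has order m(q - 1) - r -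
  -- 1, so its defect is r + 1.
  · rw [symplecticDual_plotkinSum, min_comm,
      ← GRM_eq_euclideanDual (r := r) (s := m * (Fintype.card F - 1) - r - 1) (by omega),
      ← GRM_eq_euclideanDual (r := i) (s := m * (Fintype.card F - 1) - i - 1) (by omega),
      ← grmDist_mul_add hb_i', ← grmDist_mul_add hb_r', ← h_i', ← h_r']
    have hr1 : r + 1 = m * (Fintype.card F - 1) - (m * (Fintype.card F - 1) - r - 1) := by omega
    have hi1 : i + 1 = m * (Fintype.card F - 1) - (m * (Fintype.card F - 1) - i - 1) := by omega
    rw [hr1, hi1]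
    exact isLeast_symplecticWeight_plotkinSum (isLeast_ncard_support_GRM (by omega))
      (isLeast_ncard_support_GRM (by omega))
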